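/- **Proposition ($\Omega_0^{-1}B_0\in\mathcal L^2$ as a pivotal condition).** Let $\mathfrak h=\bigoplus_{[k]\in\mathbb Z/\{-1,1\}}\mathbb C^2$ (an $\ell^2$-space with its natural complex conjugation), where $[k]=\{k,-k\}$. For a bounded operator $X$ let $\bar X f=\overline{X\bar f}$ and $X^{\mathrm t}=\overline{X^*}$ (similarly for densely defined operators), let $\mathcal L^2(\mathfrak h)$ be the space of Hilbert–Schmidt operators, and $\|X\|_2=\sqrt{\operatorname{tr}(X^*X)}$. There are real numbers $\omega_k>0$ ($k\in\mathbb Z$) and $b_k=b_{-k}$ such that the operators $$\Omega_0=\bigoplus_{[k]\in\mathbb Z/\{-1,1\}}\begin{pmatrix}\omega_{-k}&0\\0&\omega_k\end{pmatrix},\qquad B_0=\bigoplus_{[k]\in\mathbb Z/\{-1,1\}}\begin{pmatrix}0&b_k\\b_k&0\end{pmatrix}$$ on $\mathfrak h$ have the following properties. 1. (A1) $\Omega_0=\Omega_0^*\ge 0$. (A2) $B_0=B_0^{\mathrm t}\in\mathcal L^2(\mathfrak h)$ and $B_0\neq 0$. (A3) $\Omega_0$ is invertible on $\operatorname{Ran}B_0$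 and $\Omega_0\ge 4B_0(\Omega_0^{\mathrm t})^{-1}\bar B_0$. (A4) $\Omega_0^{-1/2}B_0\in\mathcal L^2(\mathfrak h)$. 2. $\omega_k^2>4b_k^2$ and $\omega_{-k}^2>4b_k^2$ for all $[k]$, and $\mathbf 1>4B_0(\Omega_0^{\mathrm t})^{-2}\bar B_0$ in the sense of quadratic forms, i.e. $4\|(\Omega_0^{\mathrm t})^{-1}\bar B_0x\|^2<\|x\|^2$ for all $x\ne0$. 3. $\Omega_0^{-1+\varepsilon}B_0\in\mathcal L^2(\mathfrak h)$ for every $\varepsilon>0$. 4. The system $$\partial_t\Omega_t=-16B_t\bar B_t,\qquad \partial_tB_t=-2\left(\Omega_tB_t+B_t\Omega_t^{\mathrm t}\right),$$ with initial value $(\Omega_0,B_0)$ at $t=0$, has exactly one solution $(\Omega_t,B_t)_{t\ge0}$, a solution being a family with $\Omega_t=\Omega_t^*\ge0$, $\Omega_t-\Omega_0\in\mathcal L^2(\mathfrak h)$, $B_t\in\mathcal L^2(\mathfrak h)$ and $t\mapsto B_t$ continuous on $[0,\infty)$ in $\mathcal L^2(\mathfrak h)$, for which the first equation holds for $t\ge0$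 and the second for $t>0$, both in the Hilbert–Schmidt topology. 5. For this solution there are $c>0$ and $T>0$ with $\|B_t\|_2\ge c\,t^{-1}$ for all $t\ge T$. In particular, $t\mapsto\|B_t\|_2$ is not integrable on $[0,\infty)$. -/

import Mathlib

namespace QuadFlow

open Filter Topology

noncomputable section

/-! ### Operators on `ℓ²(ι)` -/

/-- The complex Hilbert space `ℓ²(ι)`, that is, `L²(ι)` for the counting measure. -/
abbrev Hil (ι : Type) : Type := lp (fun _ : ι => ℂ) 2

/-- The pointwise complex conjugation of `ℓ²(ι)`, as an antilinear map. -/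
def conjL (ι : Type) : Hil ι →L⋆[ℂ] Hil ι := (starL ℂ : Hil ι ≃L⋆[ℂ] Hil ι)

theorem conjL_apply {ι : Type} (x : Hil ι) : conjL ι x = star x := rfl

/-- Complex conjugate `X̄ : x ↦ conj (X (conj x))` of a bounded operator. -/
def conjOp {ι : Type} (X : Hil ι →L[ℂ] Hil ι) : Hil ι →L[ℂ] Hil ι :=
  ((conjL ι).comp X).comp (conjL ι)

theorem conjOp_apply {ι : Type} (X : Hil ι →L[ℂ] Hil ι) (x : Hil ι) :
    conjOp X x = star (X (star x)) := rfl

/-- Transpose `Xᵗ`, the complex conjugate of the adjoint of a bounded operator. -/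
def transOp {ι : Type} (X : Hil ι →L[ℂ] Hil ι) : Hil ι →L[ℂ] Hil ι :=
  conjOp (ContinuousLinearMap.adjoint X)

/-- Transposes are characterized by `⟨f | Xᵗ g⟩ = ⟨conj g | X (conj f)⟩`. -/
theorem inner_transOp {ι : Type} (X : Hil ι →L[ℂ] Hil ι) (f g : Hil ι) :
    inner ℂ f (transOp X g) = inner ℂ (star g) (X (star f)) := by
  have key : ∀ u v : Hil ι, inner ℂ u (star v) = inner ℂ v (star u) := by
    intro u v
    simp only [lp.inner_eq_tsum]
    refine tsum_congr fun i => ?_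
    simp [mul_comm]
  rw [transOp, conjOp_apply, key, ContinuousLinearMap.adjoint_inner_left]

/-- Complex conjugate of a possibly unbounded operator. -/
def conjPMap {ι : Type} (A : Hil ι →ₗ.[ℂ] Hil ι) : Hil ι →ₗ.[ℂ] Hil ι where
  domain := A.domain.comap (conjL ι : Hil ι →ₗ⋆[ℂ] Hil ι)
  toFun :=
    { toFun := fun x => star (A ⟨star (x : Hil ι), x.2⟩)
      map_add' := fun x y => by
        rw [← star_add, ← LinearPMap.map_add]
        congr 2
        exact Subtype.ext (star_add (x : Hil ι) (y : Hil ι))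
      map_smul' := fun c x => by
        have h : A ⟨star ((c • x : _) : Hil ι), (c • x).2⟩
            = star c • A ⟨star (x : Hil ι), x.2⟩ := by
          rw [← LinearPMap.map_smul]
          congr 1
          exact Subtype.ext (star_smul c (x : Hil ι))
        rw [h, star_smul, star_star]
        rfl }

/-- Transpose of a possibly unbounded operator, the complex conjugate of its adjoint. -/
def transPMap {ι : Type} (A : Hil ι →ₗ.[ℂ] Hil ι) : Hil ι →ₗ.[ℂ] Hil ι :=
  conjPMap A.adjoint

/-- The multiplication operator `x ↦ (f i * x i)ᵢ` with its maximal domain. -/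
def diagOp {ι : Type} (f : ι → ℝ) : Hil ι →ₗ.[ℂ] Hil ι where
  domain :=
    { carrier := {x | Memℓp (fun i => (f i : ℂ) * x i) 2}
      add_mem' := fun {x y} hx hy => by
        have h := Memℓp.add hx hy
        have e : (fun i => (f i : ℂ) * x i) + (fun i => (f i : ℂ) * y i)
            = fun i => (f i : ℂ) * (x + y : Hil ι) i := by
          funext i
          simp [mul_add]
        change Memℓp (fun i => (f i : ℂ) * (x + y : Hil ι) i) 2
        rw [← e]
        exact h
      zero_mem' := by
        have e : (fun i => (f i : ℂ) * (0 : Hil ι) i) = 0 := by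
          funext i
          simp
        change Memℓp (fun i => (f i : ℂ) * (0 : Hil ι) i) 2
        rw [e]
        exact zero_memℓp
      smul_mem' := fun c x hx => by
        have h := Memℓp.const_smul hx c
        have e : c • (fun i => (f i : ℂ) * x i)
            = fun i => (f i : ℂ) * (c • x : Hil ι) i := by
          funext i
          simp [mul_left_comm]
        change Memℓp (fun i => (f i : ℂ) * (c • x : Hil ι) i) 2
        rw [← e]
        exact h }
  toFun :=
    { toFun := fun x => ⟨fun i => (f i : ℂ) * (x : Hil ι) i, x.2⟩
      map_add' := fun x y => by
        refine lp.ext (funext fun i => ?_)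
        exact mul_add _ _ _
      map_smul' := fun c x => by
        refine lp.ext (funext fun i => ?_)
        simp [mul_left_comm] }

/-- `X` is Hilbert–Schmidt: `tr (X* X) = ∑ᵢ ‖X eᵢ‖² < ∞`, with the canonical basis of `ℓ²(ι)`. -/
def IsHS {ι : Type} [DecidableEq ι] (X : Hil ι →L[ℂ] Hil ι) : Prop :=
  Summable fun i => ‖X (lp.single 2 i (1 : ℂ))‖ ^ 2

/-- The Hilbert–Schmidt norm `‖X‖₂ = √(tr (X* X))` of a Hilbert–Schmidt operator. -/
def hsNorm {ι : Type} [DecidableEq ι] (X : Hil ι →L[ℂ] Hil ι) : ℝ :=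
  Real.sqrt (∑' i, ‖X (lp.single 2 i (1 : ℂ))‖ ^ 2)

/-- `F` tends to `L` along `l` in the Hilbert–Schmidt topology. -/
def HSTendsto {ι : Type} [DecidableEq ι] (F : ℝ → (Hil ι →L[ℂ] Hil ι)) (l : Filter ℝ)
    (L : Hil ι →L[ℂ] Hil ι) : Prop :=
  (∀ᶠ s in l, IsHS (F s - L)) ∧ Tendsto (fun s => hsNorm (F s - L)) l (𝓝 0)

/-- On `[0, ∞)`, the map `F` has at `t` the derivative `D` in the Hilbert–Schmidt topology. -/
def HasHSDeriv {ι : Type} [DecidableEq ι] (F : ℝ → (Hil ι →L[ℂ] Hil ι))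
    (D : Hil ι →L[ℂ] Hil ι) (t : ℝ) : Prop :=
  IsHS D ∧
    HSTendsto (fun s => ((s - t : ℝ) : ℂ)⁻¹ • (F s - F t)) (𝓝[Set.Ici 0 \ {t}] t) D

/-- `A B` is defined on the whole space and is a Hilbert–Schmidt operator. -/
def MulIsHS {ι : Type} [DecidableEq ι] (A : Hil ι →ₗ.[ℂ] Hil ι)
    (B : Hil ι →L[ℂ] Hil ι) : Prop :=
  ∃ C : Hil ι →L[ℂ] Hil ι, IsHS C ∧ ∀ x, ∃ h : B x ∈ A.domain, A ⟨B x, h⟩ = C x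

/-! ### The conditions on the initial data -/

/-- `Ω = Ω* ≥ 0`. -/
def CondA1 {ι : Type} (Ω : Hil ι →ₗ.[ℂ] Hil ι) : Prop :=
  IsSelfAdjoint Ω ∧ ∀ x : Ω.domain, 0 ≤ (inner ℂ (x : Hil ι) (Ω x)).re

/-- `B = Bᵗ` is a non-zero Hilbert–Schmidt operator. -/
def CondA2 {ι : Type} [DecidableEq ι] (B : Hil ι →L[ℂ] Hil ι) : Prop :=
  transOp B = B ∧ IsHS B ∧ B ≠ 0

/-- `Ω` is invertible on `Ran B` and `Ω ≥ 4 B (Ωᵗ)⁻¹ B̄`; here `y = (Ωᵗ)⁻¹ B̄ x`. -/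
def CondA3 {ι : Type} (Ω : Hil ι →ₗ.[ℂ] Hil ι) (B : Hil ι →L[ℂ] Hil ι) : Prop :=
  (∀ z, ∃! y : Ω.domain, Ω y = B z) ∧
    ∀ x : Ω.domain, ∃ y : (transPMap Ω).domain, transPMap Ω y = conjOp B x ∧
      4 * (inner ℂ (x : Hil ι) (B y)).re ≤ (inner ℂ (x : Hil ι) (Ω x)).re

/-- `1 > 4 B (Ωᵗ)⁻² B̄` in the sense of quadratic forms, for `Ω = Ω*` and `B = Bᵗ`:
`4 ‖(Ωᵗ)⁻¹ B̄ x‖² < ‖x‖²` for all `x ≠ 0`; here `y = (Ωᵗ)⁻¹ B̄ x`. -/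
def StrictIneq {ι : Type} (Ω : Hil ι →ₗ.[ℂ] Hil ι) (B : Hil ι →L[ℂ] Hil ι) : Prop :=
  ∀ x : Hil ι, x ≠ 0 → ∃ y : (transPMap Ω).domain, transPMap Ω y = conjOp B x ∧
    4 * ‖(y : Hil ι)‖ ^ 2 < ‖x‖ ^ 2

/-! ### The flow -/

/-- `(Ω_t, B_t)_{t ≥ 0}` solves
`∂ₜ Ω_t = -16 B_t B̄_t`, `∂ₜ B_t = -2 (Ω_t B_t + B_t Ω_tᵗ)` with initial value `(Ω₀, B₀)`:
* the `Ω_t` are self-adjoint and positive, `Δ_t = Ω_t - Ω₀` is Hilbert–Schmidt, and the first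
  equation holds on `[0, ∞)` in the Hilbert–Schmidt topology;
* `t ↦ B_t` is continuous on `[0, ∞)` in the Hilbert–Schmidt topology, and the second equation
  holds for `t > 0` in this topology, its right-hand side being the Hilbert–Schmidt operator
  that agrees with `-2 (Ω_t B_t + B_t Ω_tᵗ)` on the dense domain of `Ω_tᵗ`.
Values at negative times are irrelevant. -/
structure IsFlow {ι : Type} [DecidableEq ι] (Ω₀ : Hil ι →ₗ.[ℂ] Hil ι)
    (B₀ : Hil ι →L[ℂ] Hil ι) (Ω : ℝ → (Hil ι →ₗ.[ℂ] Hil ι))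
    (B : ℝ → (Hil ι →L[ℂ] Hil ι)) : Prop where
  omega_zero : Ω 0 = Ω₀
  b_zero : B 0 = B₀
  omega_pos : ∀ t, 0 ≤ t → CondA1 (Ω t)
  b_hs : ∀ t, 0 ≤ t → IsHS (B t)
  b_cont : ∀ t, 0 ≤ t → HSTendsto B (𝓝[Set.Ici 0] t) (B t)
  omega_deriv : ∃ Δ : ℝ → (Hil ι →L[ℂ] Hil ι), ∀ t, 0 ≤ t →
    IsHS (Δ t) ∧ Ω t = (Δ t : Hil ι →ₗ[ℂ] Hil ι) +ᵥ Ω₀ ∧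
      HasHSDeriv Δ (-(16 : ℂ) • (B t).comp (conjOp (B t))) t
  b_deriv : ∀ t, 0 < t → ∃ D : Hil ι →L[ℂ] Hil ι, HasHSDeriv B D t ∧
    ∀ x : (transPMap (Ω t)).domain, ∃ h : B t x ∈ (Ω t).domain,
      D x = -(2 : ℂ) • (Ω t ⟨B t x, h⟩ + B t (transPMap (Ω t) x))

/-! ### Direct sums of `2 × 2` blocks -/

/-- Index set of `⨁_{[k] ∈ ℤ/{±1}} ℂ²`: the class `[k] = {k, -k}` is given by `|k| ∈ ℕ`, and
`false`, `true` are the two coordinates of its block, belonging to `-|k|` and `|k|`. -/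
abbrev Ix : Type := ℕ × Bool

/-- The integer to which a coordinate belongs. -/
def mode : Ix → ℤ
  | (k, false) => -(k : ℤ)
  | (k, true) => (k : ℤ)

/-- The real power `Ω₀ˢ` of `Ω₀ = ⨁_{[k]} diag (ω₋ₖ, ωₖ)`, for positive `ω`: the diagonal
operator `⨁_{[k]} diag (ω₋ₖˢ, ωₖˢ)`. -/
def blockPow (ω : ℤ → ℝ) (s : ℝ) : Hil Ix →ₗ.[ℂ] Hil Ix :=
  diagOp fun i => ω (mode i) ^ s

/-- The operator `Ω₀ = ⨁_{[k]} diag (ω₋ₖ, ωₖ)`. -/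
def blockOmega (ω : ℤ → ℝ) : Hil Ix →ₗ.[ℂ] Hil Ix :=
  diagOp fun i => ω (mode i)

/-- `B` is the direct sum over `[k]` of the matrices with rows `(0, bₖ)` and `(bₖ, 0)`. -/
def IsBlockB (b : ℕ → ℝ) (B : Hil Ix →L[ℂ] Hil Ix) : Prop :=
  ∀ (x : Hil Ix) (k : ℕ) (s : Bool), B x (k, s) = (b k : ℂ) * x (k, !s)

end

end QuadFlow

namespace QuadFlow

open Filter Topology

noncomputable section

section

/-! The flow preserves the block structure, so everything can be made explicit. In a block with
equal diagonal entries `w` and off-diagonal entry `b` it reads `w' = -16 b²`, `b' = -4 w b`. It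
conserves `w² - 4b²`, and with the value `1` it is solved by `w(s) = coth (4s+1)`, `b(s) = 1 / (2
sinh (4s+1))`. If `(w, b)` is a solution, so is `(λ w(λt), λ b(λt))`. The example puts this solution
with `λ = 2⁻ᵏ` into the block `[k]`.

At `t = 0` the quotient `b/w = 1 / (2 cosh 1) < 1/2` is the same in all blocks. Hence `Ω₀⁻¹B₀` is a
multiple of a permutation of coordinates, bounded but not Hilbert–Schmidt, whereas `Ω₀^(-1+ε) B₀`
has entries of size `2^(-εk)` and is Hilbert–Schmidt (`mulIsHS_blockPow`). Smaller blocks decay more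
slowly: at time `t` the block with `2ᵏ ≤ t < 2ᵏ⁺¹` still has an entry of order `1/t`
(`div_le_hsNorm_of_entries`), and `1/t` is not integrable at infinity.

Existence (`exists_isFlow_of_entries`) follows from entrywise Taylor bounds dominated by a
square-summable sequence. For uniqueness (`IsFlow.unique`), `Ω₀` is bounded here and the
Hilbert–Schmidt norm dominates the operator norm, so any flow solves an ordinary differential
equation with locally Lipschitz right-hand side. -/

theorem memHil_iff {ι : Type} {f : ι → ℂ} : Memℓp f 2 ↔ Summable fun i => ‖f i‖ ^ 2 := by
  have h := memℓp_gen_iff (E := fun _ : ι => ℂ) (p := 2) (f := f) (by norm_num)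
  simpa using h

theorem summable_norm_sq {ι : Type} (x : Hil ι) : Summable fun i => ‖x i‖ ^ 2 :=
  memHil_iff.1 (lp.memℓp x)

theorem hil_norm_sq {ι : Type} (x : Hil ι) : ‖x‖ ^ 2 = ∑' i, ‖x i‖ ^ 2 := by
  have h := lp.norm_rpow_eq_tsum (E := fun _ : ι => ℂ) (p := 2) (by norm_num) x
  simpa using h

/-! ### Weighted permutations of coordinates -/

/-- `X` permutes the coordinates by `σ` and multiplies them by the weights `a`. -/
def IsWeighted {ι : Type} (a : ι → ℝ) (σ : Equiv.Perm ι) (X : Hil ι →L[ℂ] Hil ι) : Prop :=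
  ∀ (x : Hil ι) (i : ι), X x i = (a i : ℂ) * x (σ i)

theorem exists_isWeighted {ι : Type} (a : ι → ℝ) (σ : Equiv.Perm ι) {M : ℝ} (hM0 : 0 ≤ M)
    (hle : ∀ i, a i ^ 2 ≤ M) : ∃ X : Hil ι →L[ℂ] Hil ι, IsWeighted a σ X := by
  have hb : ∀ (x : Hil ι) i, ‖(a i : ℂ) * x (σ i)‖ ^ 2 ≤ M * ‖x (σ i)‖ ^ 2 := fun x i => by
    rw [norm_mul, mul_pow, Complex.norm_real, Real.norm_eq_abs, sq_abs]
    exact mul_le_mul_of_nonneg_right (hle i) (sq_nonneg _)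
  have hs : ∀ x : Hil ι, Summable fun i => M * ‖x (σ i)‖ ^ 2 := fun x =>
    (σ.summable_iff.2 (summable_norm_sq x)).mul_left M
  have hmem : ∀ x : Hil ι, Memℓp (fun i => (a i : ℂ) * x (σ i)) 2 := fun x =>
    memHil_iff.2 (Summable.of_nonneg_of_le (fun i => sq_nonneg _) (hb x) (hs x))
  let L : Hil ι →ₗ[ℂ] Hil ι :=
    { toFun := fun x => ⟨fun i => (a i : ℂ) * x (σ i), hmem x⟩
      map_add' := fun x y => lp.ext (funext fun i => mul_add _ _ _)
      map_smul' := fun c x => lp.ext (funext fun i => by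
        simp [mul_left_comm]) }
  have hL : ∀ x, ‖L x‖ ≤ Real.sqrt M * ‖x‖ := fun x => by
    refine le_of_sq_le_sq ?_ (by positivity)
    rw [mul_pow, Real.sq_sqrt hM0, hil_norm_sq, hil_norm_sq, ← σ.tsum_eq fun i => ‖x i‖ ^ 2,
      ← tsum_mul_left]
    exact (summable_norm_sq (L x)).tsum_le_tsum (hb x) (hs x)
  exact ⟨L.mkContinuous _ hL, fun x i => rfl⟩

namespace IsWeighted

variable {ι : Type} {a b : ι → ℝ} {σ τ : Equiv.Perm ι} {X Y : Hil ι →L[ℂ] Hil ι}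

theorem congr (hX : IsWeighted a σ X) (ha : ∀ i, a i = b i) (hσ : ∀ i, σ i = τ i) :
    IsWeighted b τ X := fun x i => by rw [hX, ha, hσ]

theorem add (hX : IsWeighted a σ X) (hY : IsWeighted b σ Y) :
    IsWeighted (fun i => a i + b i) σ (X + Y) := fun x i => by
  have : (X + Y) x i = X x i + Y x i := rfl
  rw [this, hX, hY]
  push_cast
  ring

theorem sub (hX : IsWeighted a σ X) (hY : IsWeighted b σ Y) :
    IsWeighted (fun i => a i - b i) σ (X - Y) := fun x i => by
  have : (X - Y) x i = X x i - Y x i := rfl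
  rw [this, hX, hY]
  push_cast
  ring

theorem smul (c : ℝ) (hX : IsWeighted a σ X) :
    IsWeighted (fun i => c * a i) σ ((c : ℂ) • X) := fun x i => by
  have : ((c : ℂ) • X) x i = (c : ℂ) * X x i := rfl
  rw [this, hX]
  push_cast
  ring

theorem comp (hX : IsWeighted a σ X) (hY : IsWeighted b τ Y) :
    IsWeighted (fun i => a i * b (σ i)) (σ.trans τ) (X.comp Y) := fun x i => by
  rw [ContinuousLinearMap.comp_apply, hX, hY]
  push_cast
  rw [mul_assoc]
  rfl

theorem ext (hX : IsWeighted a σ X) (hY : IsWeighted a σ Y) : X = Y :=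
  ContinuousLinearMap.ext fun x => lp.ext (funext fun i => by rw [hX, hY])

theorem conjOp_eq (hX : IsWeighted a σ X) : conjOp X = X :=
  ContinuousLinearMap.ext fun x => lp.ext (funext fun i => by
    rw [conjOp_apply, lp.star_apply, hX, hX, lp.star_apply]
    simp)

/-- The matrix is real with entry `a i` at `(i, σ i)`; for an involution `σ` and `σ`-invariant
weights it is symmetric. -/
theorem adjoint_eq (hX : IsWeighted a σ X) (hσ : ∀ i, σ (σ i) = i) (ha : ∀ i, a (σ i) = a i) :
    ContinuousLinearMap.adjoint X = X := by
  refine ((ContinuousLinearMap.eq_adjoint_iff X X).2 fun x y => ?_).symm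
  rw [lp.inner_eq_tsum, lp.inner_eq_tsum, ← σ.tsum_eq]
  refine tsum_congr fun i => ?_
  rw [hX, hX, hσ, ha]
  simp
  ring

theorem transOp_eq (hX : IsWeighted a σ X) (hσ : ∀ i, σ (σ i) = i) (ha : ∀ i, a (σ i) = a i) :
    transOp X = X := by
  rw [transOp, hX.adjoint_eq hσ ha, hX.conjOp_eq]

theorem inner_re_nonneg (hX : IsWeighted a (Equiv.refl ι) X) (ha : ∀ i, 0 ≤ a i) (x : Hil ι) :
    0 ≤ (inner ℂ x (X x)).re := by
  rw [lp.inner_eq_tsum, Complex.re_tsum (lp.summable_inner _ _)]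
  refine tsum_nonneg fun i => ?_
  have e : inner ℂ (x i) (X x i) = ((a i * ‖x i‖ ^ 2 : ℝ) : ℂ) := by
    rw [hX, Equiv.refl_apply, ← smul_eq_mul, inner_smul_right, inner_self_eq_norm_sq_to_K]
    push_cast
    rfl
  rw [e, Complex.ofReal_re]
  exact mul_nonneg (ha i) (sq_nonneg _)

variable [DecidableEq ι]

theorem norm_single_sq (hX : IsWeighted a σ X) (i : ι) :
    ‖X (lp.single 2 i (1 : ℂ))‖ ^ 2 = a (σ.symm i) ^ 2 := by
  rw [hil_norm_sq, tsum_eq_single (σ.symm i)]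
  · rw [hX]
    simp
  · intro j hj
    rw [hX, lp.single_apply_ne, mul_zero, norm_zero]
    · norm_num
    · rintro rfl
      simp at hj

theorem isHS (hX : IsWeighted a σ X) (ha : Summable fun i => a i ^ 2) : IsHS X := by
  unfold IsHS
  simp only [hX.norm_single_sq]
  exact (σ.symm.summable_iff (f := fun i => a i ^ 2)).2 ha

theorem hsNorm_eq (hX : IsWeighted a σ X) : hsNorm X = Real.sqrt (∑' i, a i ^ 2) := by
  unfold hsNorm
  simp only [hX.norm_single_sq]
  rw [σ.symm.tsum_eq fun i => a i ^ 2]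

theorem abs_le_hsNorm (hX : IsWeighted a σ X) (ha : Summable fun i => a i ^ 2) (i : ι) :
    |a i| ≤ hsNorm X := by
  rw [hX.hsNorm_eq, ← Real.sqrt_sq_eq_abs]
  exact Real.sqrt_le_sqrt (ha.le_tsum i fun j _ => sq_nonneg _)

/-- The factor `r` is kept apart from `C` so that one square-summable `C` serves all times; in the
applications `r = |u - t|`. -/
theorem hsNorm_le (hX : IsWeighted a σ X) {C : ι → ℝ} (hC : Summable fun i => C i ^ 2) {r : ℝ}
    (hr : 0 ≤ r) (h : ∀ i, |a i| ≤ r * C i) :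
    IsHS X ∧ hsNorm X ≤ r * Real.sqrt (∑' i, C i ^ 2) := by
  have hle : ∀ i, a i ^ 2 ≤ r ^ 2 * C i ^ 2 := fun i => by
    rw [← sq_abs, ← mul_pow]
    exact pow_le_pow_left₀ (abs_nonneg _) (h i) 2
  have hs : Summable fun i => a i ^ 2 :=
    Summable.of_nonneg_of_le (fun i => sq_nonneg _) hle (hC.mul_left _)
  refine ⟨hX.isHS hs, ?_⟩
  rw [hX.hsNorm_eq]
  calc Real.sqrt (∑' i, a i ^ 2) ≤ Real.sqrt (r ^ 2 * ∑' i, C i ^ 2) := by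
        rw [← tsum_mul_left]
        exact Real.sqrt_le_sqrt (hs.tsum_le_tsum hle (hC.mul_left _))
    _ = r * Real.sqrt (∑' i, C i ^ 2) := by
        rw [Real.sqrt_mul (sq_nonneg r), Real.sqrt_sq hr]

end IsWeighted

/-! ### Hilbert–Schmidt limits and derivatives from entrywise bounds -/

variable {ι : Type} [DecidableEq ι]

theorem hsTendsto_of_isWeighted {F : ℝ → (Hil ι →L[ℂ] Hil ι)} {L : Hil ι →L[ℂ] Hil ι}
    {σ : Equiv.Perm ι} {a : ℝ → ι → ℝ} {l C : ι → ℝ} {s : Set ℝ} {t : ℝ}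
    (hF : ∀ u ∈ s, IsWeighted (a u) σ (F u)) (hL : IsWeighted l σ L)
    (hC : Summable fun i => C i ^ 2) (h : ∀ u ∈ s, ∀ i, |a u i - l i| ≤ |u - t| * C i) :
    HSTendsto F (𝓝[s] t) L := by
  have key : ∀ u ∈ s, IsHS (F u - L) ∧ hsNorm (F u - L) ≤ |u - t| * Real.sqrt (∑' i, C i ^ 2) :=
    fun u hu => ((hF u hu).sub hL).hsNorm_le hC (abs_nonneg _) (h u hu)
  refine ⟨eventually_mem_nhdsWithin.mono fun u hu => (key u hu).1, ?_⟩
  have hlim : Tendsto (fun u => |u - t| * Real.sqrt (∑' i, C i ^ 2)) (𝓝[s] t) (𝓝 0) := by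
    have hc : Continuous fun u : ℝ => |u - t| * Real.sqrt (∑' i, C i ^ 2) := by fun_prop
    have h0 := hc.tendsto t
    simp only [sub_self, abs_zero, zero_mul] at h0
    exact h0.mono_left nhdsWithin_le_nhds
  exact squeeze_zero' (Eventually.of_forall fun u => Real.sqrt_nonneg _)
    (eventually_mem_nhdsWithin.mono fun u hu => (key u hu).2) hlim

/-- Dividing the second-order Taylor bound by `|u - t|` shows that the difference quotients converge
at a rate `|u - t| * C i`, uniformly enough for `hsTendsto_of_isWeighted`. -/
theorem hasHSDeriv_of_isWeighted {F : ℝ → (Hil ι →L[ℂ] Hil ι)} {D : Hil ι →L[ℂ] Hil ι}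
    {σ : Equiv.Perm ι} {a : ℝ → ι → ℝ} {d C : ι → ℝ} {t : ℝ} (ht : 0 ≤ t)
    (hF : ∀ u, 0 ≤ u → IsWeighted (a u) σ (F u)) (hD : IsWeighted d σ D)
    (hd : Summable fun i => d i ^ 2) (hC : Summable fun i => C i ^ 2)
    (h : ∀ u, 0 ≤ u → ∀ i, |a u i - a t i - (u - t) * d i| ≤ (u - t) ^ 2 * C i) :
    HasHSDeriv F D t := by
  refine ⟨hD.isHS hd, ?_⟩
  refine hsTendsto_of_isWeighted (σ := σ) (a := fun u i => (u - t)⁻¹ * (a u i - a t i)) (C := C)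
    (fun u hu => ?_) hD hC fun u hu i => ?_
  · have := ((hF u hu.1).sub (hF t ht)).smul (u - t)⁻¹
    rwa [Complex.ofReal_inv] at this
  · have hne : u - t ≠ 0 := sub_ne_zero.2 hu.2
    have hpos : 0 < |u - t| := abs_pos.2 hne
    have e : (u - t)⁻¹ * (a u i - a t i) - d i
        = (u - t)⁻¹ * (a u i - a t i - (u - t) * d i) := by
      field_simp
    rw [e, abs_mul, abs_inv, inv_mul_le_iff₀ hpos, ← mul_assoc, ← sq, sq_abs]
    exact h u hu.1 i

/-- Cauchy–Schwarz on the finite partial sums of the expansion of `x` in the canonical basis,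
followed by a limit. -/
theorem norm_le_hsNorm {X : Hil ι →L[ℂ] Hil ι} (hX : IsHS X) : ‖X‖ ≤ hsNorm X := by
  refine X.opNorm_le_bound (Real.sqrt_nonneg _) fun x => ?_
  have hsum : HasSum (fun i => x i • X (lp.single 2 i (1 : ℂ))) (X x) := by
    have h := (lp.hasSum_single (p := 2) (by norm_num) x).mapL X
    refine h.congr_fun fun i => ?_
    rw [← map_smul, ← lp.single_smul]
    simp
  refine le_of_tendsto hsum.norm (Eventually.of_forall fun s => ?_)
  calc ‖∑ i ∈ s, x i • X (lp.single 2 i (1 : ℂ))‖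
      ≤ ∑ i ∈ s, ‖X (lp.single 2 i (1 : ℂ))‖ * ‖x i‖ :=
        norm_sum_le_of_le _ fun i _ => by rw [norm_smul, mul_comm]
    _ ≤ Real.sqrt (∑ i ∈ s, ‖X (lp.single 2 i (1 : ℂ))‖ ^ 2) * Real.sqrt (∑ i ∈ s, ‖x i‖ ^ 2) :=
        Real.sum_mul_le_sqrt_mul_sqrt _ _ _
    _ ≤ hsNorm X * ‖x‖ := by
        refine mul_le_mul (Real.sqrt_le_sqrt (hX.sum_le_tsum s fun i _ => sq_nonneg _)) ?_
          (Real.sqrt_nonneg _) (Real.sqrt_nonneg _)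
        refine Real.sqrt_le_iff.2 ⟨norm_nonneg _, ?_⟩
        rw [hil_norm_sq]
        exact (summable_norm_sq x).sum_le_tsum s fun i _ => sq_nonneg _

end

section

variable {ι : Type}

/-! ### Bounded operators as everywhere defined partial operators -/

/-- A bounded operator, seen as a partially defined operator with full domain. -/
abbrev toP (X : Hil ι →L[ℂ] Hil ι) : Hil ι →ₗ.[ℂ] Hil ι :=
  (X : Hil ι →ₗ[ℂ] Hil ι).toPMap ⊤

theorem toP_injective {X Y : Hil ι →L[ℂ] Hil ι} (h : toP X = toP Y) : X = Y :=
  ContinuousLinearMap.ext fun x => by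
    obtain ⟨_, hv⟩ := LinearPMap.ext_iff.1 h
    exact @hv x trivial trivial

theorem vadd_toP (X Y : Hil ι →L[ℂ] Hil ι) :
    (X : Hil ι →ₗ[ℂ] Hil ι) +ᵥ toP Y = toP (X + Y) := by
  refine LinearPMap.ext rfl ?_
  intro x hx hx'
  rfl

theorem toP_adjoint (X : Hil ι →L[ℂ] Hil ι) :
    (toP X).adjoint = toP (ContinuousLinearMap.adjoint X) :=
  X.toPMap_adjoint_eq_adjoint_toPMap_of_dense (p := ⊤) (by simp)

theorem transPMap_toP (X : Hil ι →L[ℂ] Hil ι) : transPMap (toP X) = toP (transOp X) := by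
  rw [transPMap, toP_adjoint]
  refine LinearPMap.ext (Submodule.comap_top _) ?_
  intro x hx hx'
  rfl

/-- When multiplication by `f` is bounded, its maximal domain is everything; this turns the
unbounded formalism into bounded operators for the example. -/
theorem diagOp_eq_toP {f : ι → ℝ} {W : Hil ι →L[ℂ] Hil ι} (hW : IsWeighted f (Equiv.refl ι) W) :
    diagOp f = toP W := by
  have e : ∀ x : Hil ι, (fun i => (f i : ℂ) * x i) = W x := fun x => funext fun i => (hW x i).symm
  refine LinearPMap.ext ?_ ?_
  · refine Submodule.ext fun x => ⟨fun _ => trivial, fun _ => ?_⟩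
    change Memℓp (fun i => (f i : ℂ) * x i) 2
    rw [e]
    exact lp.memℓp (W x)
  · intro x hx hx'
    exact lp.ext (e x)

/-! ### The flow as an ordinary differential equation in the operator norm -/

theorem norm_conjOp_le (X : Hil ι →L[ℂ] Hil ι) : ‖conjOp X‖ ≤ ‖X‖ := by
  refine (conjOp X).opNorm_le_bound (norm_nonneg _) fun x => ?_
  rw [conjOp_apply, norm_star]
  simpa using X.le_opNorm (star x)

theorem conjOp_sub (X Y : Hil ι →L[ℂ] Hil ι) : conjOp (X - Y) = conjOp X - conjOp Y :=
  ContinuousLinearMap.ext fun x => by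
    have : (conjOp X - conjOp Y) x = conjOp X x - conjOp Y x := rfl
    rw [this, conjOp_apply, conjOp_apply, conjOp_apply, ← star_sub]
    rfl

theorem norm_transOp_le (X : Hil ι →L[ℂ] Hil ι) : ‖transOp X‖ ≤ ‖X‖ :=
  (norm_conjOp_le _).trans (LinearIsometryEquiv.norm_map _ X).le

theorem transOp_sub (X Y : Hil ι →L[ℂ] Hil ι) : transOp (X - Y) = transOp X - transOp Y := by
  rw [transOp, map_sub, conjOp_sub]
  rfl

/-- The right-hand side of the flow, for `Ω_t = Δ_t + W` with bounded `W`. -/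
def flowField (W : Hil ι →L[ℂ] Hil ι) (P : (Hil ι →L[ℂ] Hil ι) × (Hil ι →L[ℂ] Hil ι)) :
    (Hil ι →L[ℂ] Hil ι) × (Hil ι →L[ℂ] Hil ι) :=
  (-(16 : ℂ) • P.2.comp (conjOp P.2),
    -(2 : ℂ) • ((P.1 + W).comp P.2 + P.2.comp (transOp (P.1 + W))))

theorem norm_comp_sub_comp_le {R r d e : ℝ} {X X' Y Y' : Hil ι →L[ℂ] Hil ι} (hX : ‖X‖ ≤ R)
    (hY' : ‖Y'‖ ≤ r) (hd : ‖X - X'‖ ≤ d) (he : ‖Y - Y'‖ ≤ e) :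
    ‖X.comp Y - X'.comp Y'‖ ≤ R * e + d * r := by
  have h : X.comp Y - X'.comp Y' = X.comp (Y - Y') + (X - X').comp Y' := by
    ext1 x
    simp
  rw [h]
  refine (norm_add_le _ _).trans (add_le_add ?_ ?_)
  · exact (ContinuousLinearMap.opNorm_comp_le _ _).trans
      (mul_le_mul hX he (norm_nonneg _) ((norm_nonneg _).trans hX))
  · exact (ContinuousLinearMap.opNorm_comp_le _ _).trans
      (mul_le_mul hd hY' (norm_nonneg _) ((norm_nonneg _).trans hd))

/-- The field is quadratic. On the ball its first component has Lipschitz constant `16 * 2R`, its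
second `2 * (4R + 2‖W‖)`; both are at most `32R + 4‖W‖`. -/
theorem lipschitzOnWith_flowField (W : Hil ι →L[ℂ] Hil ι) {R : ℝ} (hR : 0 ≤ R) :
    LipschitzOnWith (Real.toNNReal (32 * R + 4 * ‖W‖)) (flowField W) (Metric.closedBall 0 R) := by
  refine LipschitzOnWith.of_dist_le_mul fun P hP Q hQ => ?_
  rw [Real.coe_toNNReal _ (by linarith [norm_nonneg W]), dist_eq_norm, dist_eq_norm]
  rw [mem_closedBall_zero_iff] at hP hQ
  have hP1 := (norm_fst_le P).trans hP
  have hP2 := (norm_snd_le P).trans hP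
  have hQ1 := (norm_fst_le Q).trans hQ
  have hQ2 := (norm_snd_le Q).trans hQ
  have hd1 : ‖P.1 - Q.1‖ ≤ ‖P - Q‖ := norm_fst_le (P - Q)
  have hd2 : ‖P.2 - Q.2‖ ≤ ‖P - Q‖ := norm_snd_le (P - Q)
  have hPW : ‖P.1 + W‖ ≤ R + ‖W‖ := (norm_add_le _ _).trans (by linarith)
  have hQW : ‖Q.1 + W‖ ≤ R + ‖W‖ := (norm_add_le _ _).trans (by linarith)
  have hdW : ‖(P.1 + W) - (Q.1 + W)‖ ≤ ‖P - Q‖ := by simpa using hd1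
  refine max_le ?_ ?_
  · have h := norm_comp_sub_comp_le hP2 ((norm_conjOp_le Q.2).trans hQ2) hd2
      ((conjOp_sub P.2 Q.2 ▸ norm_conjOp_le (P.2 - Q.2)).trans hd2)
    change ‖-(16 : ℂ) • P.2.comp (conjOp P.2) - -(16 : ℂ) • Q.2.comp (conjOp Q.2)‖ ≤ _
    rw [← smul_sub, norm_smul, norm_neg]
    norm_num
    nlinarith [norm_nonneg (P - Q), norm_nonneg W]
  · have h1 := norm_comp_sub_comp_le hPW hQ2 hdW hd2
    have h2 := norm_comp_sub_comp_le hP2 ((norm_transOp_le (Q.1 + W)).trans hQW) hd2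
      ((transOp_sub (P.1 + W) (Q.1 + W) ▸ norm_transOp_le ((P.1 + W) - (Q.1 + W))).trans hdW)
    change ‖-(2 : ℂ) • ((P.1 + W).comp P.2 + P.2.comp (transOp (P.1 + W)))
      - -(2 : ℂ) • ((Q.1 + W).comp Q.2 + Q.2.comp (transOp (Q.1 + W)))‖ ≤ _
    rw [← smul_sub, norm_smul, norm_neg, add_sub_add_comm]
    have h3 := (norm_add_le _ _).trans (add_le_add h1 h2)
    rw [Complex.norm_ofNat]
    nlinarith [norm_nonneg (P - Q), norm_nonneg W]

theorem continuous_flowField (W : Hil ι →L[ℂ] Hil ι) : Continuous (flowField W) := by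
  refine continuous_iff_continuousAt.2 fun P => ?_
  have h := (lipschitzOnWith_flowField W (R := ‖P‖ + 1) (by positivity)).continuousOn
  refine h.continuousAt (mem_of_superset (Metric.ball_mem_nhds P one_pos) fun Q hQ => ?_)
  rw [mem_closedBall_zero_iff]
  rw [mem_ball_iff_norm] at hQ
  linarith [norm_le_insert' Q P]

/-! ### Uniqueness of the flow -/

variable [DecidableEq ι]

theorem HSTendsto.tendsto {F : ℝ → (Hil ι →L[ℂ] Hil ι)} {l : Filter ℝ} {L : Hil ι →L[ℂ] Hil ι}
    (h : HSTendsto F l L) : Tendsto F l (𝓝 L) := by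
  rw [tendsto_iff_norm_sub_tendsto_zero]
  exact squeeze_zero' (Eventually.of_forall fun _ => norm_nonneg _)
    (h.1.mono fun _ hs => norm_le_hsNorm hs) h.2

theorem HasHSDeriv.hasDerivWithinAt {F : ℝ → (Hil ι →L[ℂ] Hil ι)} {D : Hil ι →L[ℂ] Hil ι} {t : ℝ}
    (h : HasHSDeriv F D t) : HasDerivWithinAt F D (Set.Ici 0) t := by
  rw [hasDerivWithinAt_iff_tendsto_slope]
  refine h.2.tendsto.congr fun s => ?_
  rw [slope_def_module, ← Complex.ofReal_inv]
  rfl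

/-- A flow with bounded initial value is given by a trajectory of `flowField`. -/
theorem IsFlow.exists_trajectory {W B₀ : Hil ι →L[ℂ] Hil ι} {Ω : ℝ → (Hil ι →ₗ.[ℂ] Hil ι)}
    {B : ℝ → (Hil ι →L[ℂ] Hil ι)} (h : IsFlow (toP W) B₀ Ω B) :
    ∃ Δ : ℝ → (Hil ι →L[ℂ] Hil ι), Δ 0 = 0 ∧ (∀ t, 0 ≤ t → Ω t = toP (Δ t + W)) ∧
      ∀ t, 0 ≤ t → HasDerivWithinAt (fun s => (Δ s, B s)) (flowField W (Δ t, B t))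
        (Set.Ici 0) t := by
  obtain ⟨Δ, hΔ⟩ := h.omega_deriv
  have hΩ : ∀ t, 0 ≤ t → Ω t = toP (Δ t + W) := fun t ht => by
    rw [(hΔ t ht).2.1, vadd_toP]
  have hΔd : ∀ t, 0 ≤ t → HasDerivWithinAt Δ (flowField W (Δ t, B t)).1 (Set.Ici 0) t :=
    fun t ht => (hΔ t ht).2.2.hasDerivWithinAt
  have hBc : ContinuousOn B (Set.Ici 0) := fun t ht => (h.b_cont t ht).tendsto
  have hBd : ∀ t, 0 < t → HasDerivWithinAt B (flowField W (Δ t, B t)).2 (Set.Ici 0) t := by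
    intro t ht
    obtain ⟨D, hD, hDx⟩ := h.b_deriv t ht
    have e : D = (flowField W (Δ t, B t)).2 := by
      refine ContinuousLinearMap.ext fun x => ?_
      rw [hΩ t ht.le, transPMap_toP] at hDx
      obtain ⟨_, hx⟩ := hDx ⟨x, trivial⟩
      exact hx
    exact e ▸ hD.hasDerivWithinAt
  have hBd' : ∀ t, 0 < t → HasDerivAt B (flowField W (Δ t, B t)).2 t := fun t ht =>
    (hBd t ht).hasDerivAt (Ici_mem_nhds ht)
  refine ⟨Δ, ?_, hΩ, fun t ht => (hΔd t ht).prodMk ?_⟩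
  · have h0 := hΩ 0 le_rfl
    rw [h.omega_zero] at h0
    simpa using toP_injective h0
  · rcases ht.eq_or_lt with rfl | ht
    -- The second equation is only assumed for `t > 0`. At `0` the one-sided derivative is the limit
    -- of the derivatives, which exists because `B`, `Δ` and the field are continuous.
    · refine hasDerivWithinAt_Ici_of_tendsto_deriv (s := Set.Ioi 0)
        (fun t ht => (hBd' t ht).differentiableAt.differentiableWithinAt)
        ((hBc 0 Set.self_mem_Ici).mono Set.Ioi_subset_Ici_self) self_mem_nhdsWithin ?_
      have hc : ContinuousWithinAt (fun s => (flowField W (Δ s, B s)).2) (Set.Ici 0) 0 :=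
        (continuous_snd.comp (continuous_flowField W)).continuousAt.comp_continuousWithinAt
          ((hΔd 0 le_rfl).continuousWithinAt.prodMk (hBc 0 Set.self_mem_Ici))
      exact (hc.mono Set.Ioi_subset_Ici_self).tendsto.congr'
        (eventually_mem_nhdsWithin.mono fun t ht => (hBd' t ht).deriv.symm)
    · exact hBd t ht

/-- Both trajectories are bounded on the compact interval `[0, t]`, so they stay in a common ball,
where the field is Lipschitz. -/
theorem IsFlow.unique {W B₀ : Hil ι →L[ℂ] Hil ι} {Ω Ω' : ℝ → (Hil ι →ₗ.[ℂ] Hil ι)}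
    {B B' : ℝ → (Hil ι →L[ℂ] Hil ι)} (h : IsFlow (toP W) B₀ Ω B) (h' : IsFlow (toP W) B₀ Ω' B')
    {t : ℝ} (ht : 0 ≤ t) : Ω' t = Ω t ∧ B' t = B t := by
  obtain ⟨Δ, h0, hΩ, hd⟩ := h.exists_trajectory
  obtain ⟨Δ', h0', hΩ', hd'⟩ := h'.exists_trajectory
  have hc : ContinuousOn (fun s => (Δ s, B s)) (Set.Icc 0 t) := fun s hs =>
    ((hd s hs.1).mono Set.Icc_subset_Ici_self).continuousWithinAt
  have hc' : ContinuousOn (fun s => (Δ' s, B' s)) (Set.Icc 0 t) := fun s hs =>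
    ((hd' s hs.1).mono Set.Icc_subset_Ici_self).continuousWithinAt
  obtain ⟨R, hR⟩ := isCompact_Icc.exists_bound_of_continuousOn hc
  obtain ⟨R', hR'⟩ := isCompact_Icc.exists_bound_of_continuousOn hc'
  have hR0 : 0 ≤ max R R' :=
    (norm_nonneg _).trans ((hR 0 ⟨le_rfl, ht⟩).trans (le_max_left _ _))
  have heq := ODE_solution_unique_of_mem_Icc_right (v := fun _ => flowField W)
    (s := fun _ => Metric.closedBall 0 (max R R')) (f := fun s => (Δ' s, B' s))
    (g := fun s => (Δ s, B s)) (fun _ _ => lipschitzOnWith_flowField W hR0) hc'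
    (fun s hs => (hd' s hs.1).mono (Set.Ici_subset_Ici.2 hs.1))
    (fun s hs => mem_closedBall_zero_iff.2
      ((hR' s (Set.Ico_subset_Icc_self hs)).trans (le_max_right _ _))) hc
    (fun s hs => (hd s hs.1).mono (Set.Ici_subset_Ici.2 hs.1))
    (fun s hs => mem_closedBall_zero_iff.2
      ((hR s (Set.Ico_subset_Icc_self hs)).trans (le_max_left _ _)))
    (by simp only [h0, h0', h.b_zero, h'.b_zero])
  have hp := Prod.ext_iff.1 (heq ⟨ht, le_rfl⟩)
  have hp1 : Δ' t = Δ t := hp.1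
  exact ⟨by rw [hΩ t ht, hΩ' t ht, hp1], hp.2⟩

end

section

/-! ### The scalar profile of the flow -/

/-- The profile of the off-diagonal entries. -/
def profB (s : ℝ) : ℝ := (2 * Real.sinh (4 * s + 1))⁻¹

/-- The profile of the diagonal entries. -/
def profW (s : ℝ) : ℝ := Real.cosh (4 * s + 1) / Real.sinh (4 * s + 1)

theorem one_lt_sinh {s : ℝ} (hs : 0 ≤ s) : 1 < Real.sinh (4 * s + 1) :=
  (show (1 : ℝ) ≤ 4 * s + 1 by linarith).trans_lt (Real.self_lt_sinh_iff.2 (by linarith))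

theorem profB_pos {s : ℝ} (hs : 0 ≤ s) : 0 < profB s := by
  have := one_lt_sinh hs
  unfold profB
  positivity

theorem profW_pos {s : ℝ} (hs : 0 ≤ s) : 0 < profW s := by
  have := one_lt_sinh hs
  exact div_pos (Real.cosh_pos _) (by linarith)

theorem profB_le {s : ℝ} (hs : 0 ≤ s) : profB s ≤ 1 / 2 := by
  have := one_lt_sinh hs
  unfold profB
  rw [inv_le_comm₀ (by linarith) (by norm_num)]
  linarith

/-- This is `cosh² - sinh² = 1`: the conserved quantity `w² - 4b²` has the value `1`. -/
theorem profW_sq {s : ℝ} (hs : 0 ≤ s) : profW s ^ 2 = 4 * profB s ^ 2 + 1 := by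
  have := one_lt_sinh hs
  have h0 : Real.sinh (4 * s + 1) ≠ 0 := by linarith
  unfold profB profW
  field_simp
  rw [Real.cosh_sq]
  ring

theorem profW_le {s : ℝ} (hs : 0 ≤ s) : profW s ≤ 2 := by
  nlinarith [profW_sq hs, profB_le hs, profB_pos hs, profW_pos hs]

theorem hasDerivAt_profB {s : ℝ} (hs : 0 ≤ s) :
    HasDerivAt profB (-4 * (profW s * profB s)) s := by
  have h1 := one_lt_sinh hs
  have h0 : Real.sinh (4 * s + 1) ≠ 0 := by linarith
  have hl : HasDerivAt (fun s : ℝ => 4 * s + 1) 4 s := by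
    simpa using ((hasDerivAt_id s).const_mul 4).add_const 1
  have h := (hl.sinh.const_mul 2).inv (by positivity)
  refine h.congr_deriv ?_
  unfold profB profW
  field_simp

theorem hasDerivAt_profW {s : ℝ} (hs : 0 ≤ s) : HasDerivAt profW (-16 * profB s ^ 2) s := by
  have h1 := one_lt_sinh hs
  have h0 : Real.sinh (4 * s + 1) ≠ 0 := by linarith
  have hl : HasDerivAt (fun s : ℝ => 4 * s + 1) 4 s := by
    simpa using ((hasDerivAt_id s).const_mul 4).add_const 1
  have h := hl.cosh.div hl.sinh h0
  refine h.congr_deriv ?_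
  unfold profB
  field_simp
  have := Real.cosh_sq (4 * s + 1)
  linear_combination (-16) * this

theorem abs_sub_le_of_hasDerivAt {f f' : ℝ → ℝ} {L : ℝ}
    (hf : ∀ x, 0 ≤ x → HasDerivAt f (f' x) x) (hL : ∀ x, 0 ≤ x → |f' x| ≤ L) {u t : ℝ}
    (hu : 0 ≤ u) (ht : 0 ≤ t) : |f u - f t| ≤ L * |u - t| :=
  (convex_Ici (0 : ℝ)).norm_image_sub_le_of_norm_hasDerivWithin_le
    (fun x hx => (hf x hx).hasDerivWithinAt) hL ht hu

/-- Mean value inequality for `x ↦ f x - x * f' t`, whose derivative `f' x - f' t` is at most `L *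
|u - t|` between `t` and `u`. The factor `1/2` of the sharp bound is not needed. -/
theorem abs_taylor_le_of_hasDerivAt {f f' f'' : ℝ → ℝ} {L : ℝ}
    (hf : ∀ x, 0 ≤ x → HasDerivAt f (f' x) x) (hf' : ∀ x, 0 ≤ x → HasDerivAt f' (f'' x) x)
    (hL : ∀ x, 0 ≤ x → |f'' x| ≤ L) {u t : ℝ} (hu : 0 ≤ u) (ht : 0 ≤ t) :
    |f u - f t - (u - t) * f' t| ≤ L * (u - t) ^ 2 := by
  have hL0 : 0 ≤ L := (abs_nonneg _).trans (hL 0 le_rfl)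
  have hpos : ∀ x ∈ Set.uIcc t u, 0 ≤ x := fun x hx => (le_min ht hu).trans hx.1
  have h := (convex_uIcc t u).norm_image_sub_le_of_norm_hasDerivWithin_le
    (f := fun x => f x - x * f' t) (f' := fun x => f' x - f' t) (C := L * |u - t|)
    (fun x hx => by
      have := (hf x (hpos x hx)).sub ((hasDerivAt_id x).mul_const (f' t))
      rw [one_mul] at this
      exact this.hasDerivWithinAt)
    (fun x hx => (abs_sub_le_of_hasDerivAt hf' hL (hpos x hx) ht).trans
      (mul_le_mul_of_nonneg_left (Set.abs_sub_left_of_mem_uIcc hx) hL0))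
    Set.left_mem_uIcc Set.right_mem_uIcc
  rw [Real.norm_eq_abs, Real.norm_eq_abs, mul_assoc, abs_mul_abs_self, ← sq] at h
  convert h using 2
  ring

theorem profB_lipschitz {u t : ℝ} (hu : 0 ≤ u) (ht : 0 ≤ t) :
    |profB u - profB t| ≤ 4 * |u - t| := by
  refine abs_sub_le_of_hasDerivAt (fun x hx => hasDerivAt_profB hx) (fun x hx => ?_) hu ht
  have h1 := profB_pos hx
  have h2 := profB_le hx
  have h3 := profW_pos hx
  have h4 := profW_le hx
  rw [abs_le]
  constructor <;> nlinarith [mul_pos h3 h1]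

theorem profB_taylor {u t : ℝ} (hu : 0 ≤ u) (ht : 0 ≤ t) :
    |profB u - profB t - (u - t) * (-4 * (profW t * profB t))| ≤ 64 * (u - t) ^ 2 := by
  refine abs_taylor_le_of_hasDerivAt (fun x hx => hasDerivAt_profB hx)
    (fun x hx => ((hasDerivAt_profW hx).mul (hasDerivAt_profB hx)).const_mul (-4))
    (fun x hx => ?_) hu ht
  have h1 := profB_pos hx
  have h2 := profB_le hx
  have h3 := profW_sq hx
  have h4 : profB x ^ 3 ≤ (1 / 2) ^ 3 := pow_le_pow_left₀ h1.le h2 3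
  -- Eliminating `profW` through the conserved quantity; with `profB ≤ 1/2` the result is at most
  -- `24`.
  have e : -4 * (-16 * profB x ^ 2 * profB x + profW x * (-4 * (profW x * profB x)))
      = 128 * profB x ^ 3 + 16 * profB x := by
    linear_combination 16 * profB x * h3
  rw [e, abs_of_nonneg (by positivity)]
  linarith

theorem profW_taylor {u t : ℝ} (hu : 0 ≤ u) (ht : 0 ≤ t) :
    |profW u - profW t - (u - t) * (-16 * profB t ^ 2)| ≤ 64 * (u - t) ^ 2 := by
  refine abs_taylor_le_of_hasDerivAt (fun x hx => hasDerivAt_profW hx)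
    (fun x hx => ((hasDerivAt_profB hx).pow 2).const_mul (-16)) (fun x hx => ?_) hu ht
  have h1 := profB_pos hx
  have h2 := profB_le hx
  have h3 := profW_pos hx
  have h4 := profW_le hx
  have h5 : profB x ^ 2 ≤ (1 / 2) ^ 2 := pow_le_pow_left₀ h1.le h2 2
  have e : -16 * (((2 : ℕ) : ℝ) * profB x ^ (2 - 1) * (-4 * (profW x * profB x)))
      = 128 * (profW x * profB x ^ 2) := by
    norm_num
    ring
  rw [e, abs_of_nonneg (by positivity)]
  nlinarith [mul_le_mul h4 h5 (sq_nonneg _) (by norm_num)]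

theorem profB_anti {s : ℝ} (hs : 0 ≤ s) (hs' : s ≤ 2) : profB 2 ≤ profB s := by
  have := one_lt_sinh hs
  refine inv_anti₀ (by linarith) ?_
  have := Real.sinh_le_sinh.2 (show 4 * s + 1 ≤ 4 * 2 + 1 by linarith)
  linarith

/-! ### The dyadic example -/

/-- The scale of a block. -/
def scale (i : Ix) : ℝ := (1 / 2) ^ i.1

theorem scale_pos (i : Ix) : 0 < scale i := by
  unfold scale
  positivity

theorem scale_le_one (i : Ix) : scale i ≤ 1 := pow_le_one₀ (by norm_num) (by norm_num)

/-- The exchange of the two coordinates of each block. -/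
def flip : Equiv.Perm Ix := (Equiv.refl ℕ).prodCongr Equiv.boolNot

theorem flip_flip (i : Ix) : flip (flip i) = i :=
  Prod.ext rfl (Bool.not_not i.2)

theorem summable_geometric_Ix {r : ℝ} (hr : 0 ≤ r) (hr1 : r < 1) :
    Summable fun i : Ix => (r ^ i.1) ^ 2 := by
  have h1 : Summable fun k : ℕ => (r ^ k) ^ 2 := by
    simp only [pow_right_comm r _ 2]
    exact summable_geometric_of_lt_one (sq_nonneg r) (pow_lt_one₀ hr hr1 two_ne_zero)
  have h2 : Summable fun _ : Bool => (1 : ℝ) := (hasSum_fintype _).summable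
  simpa using h1.mul_of_nonneg h2 (fun k => sq_nonneg _) fun _ => zero_le_one

theorem summable_const_mul_scale_sq (M : ℝ) : Summable fun i => (M * scale i) ^ 2 := by
  simp only [mul_pow]
  exact (summable_geometric_Ix (r := 1 / 2) (by norm_num) (by norm_num)).mul_left (M ^ 2)

theorem summable_sq_of_le_scale {a : Ix → ℝ} {M : ℝ} (h : ∀ i, |a i| ≤ M * scale i) :
    Summable fun i => a i ^ 2 := by
  refine Summable.of_nonneg_of_le (fun i => sq_nonneg _) (fun i => ?_)
    (summable_const_mul_scale_sq M)
  rw [← sq_abs]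
  exact pow_le_pow_left₀ (abs_nonneg _) (h i) 2

theorem exists_isWeighted_of_le_scale {a : Ix → ℝ} (σ : Equiv.Perm Ix) {M : ℝ}
    (h : ∀ i, |a i| ≤ M * scale i) : ∃ X : Hil Ix →L[ℂ] Hil Ix, IsWeighted a σ X :=
  exists_isWeighted a σ (tsum_nonneg fun _ => sq_nonneg _) fun i =>
    (summable_sq_of_le_scale h).le_tsum i fun _ _ => sq_nonneg _

/-- The off-diagonal entries at time `t`. -/
def entB (t : ℝ) (i : Ix) : ℝ := scale i * profB (scale i * t)

/-- The diagonal entries at time `t`. -/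
def entW (t : ℝ) (i : Ix) : ℝ := scale i * profW (scale i * t)

theorem scale_mul_nonneg {t : ℝ} (ht : 0 ≤ t) (i : Ix) : 0 ≤ scale i * t :=
  mul_nonneg (scale_pos i).le ht

theorem entB_pos {t : ℝ} (ht : 0 ≤ t) (i : Ix) : 0 < entB t i :=
  mul_pos (scale_pos i) (profB_pos (scale_mul_nonneg ht i))

theorem entW_pos {t : ℝ} (ht : 0 ≤ t) (i : Ix) : 0 < entW t i :=
  mul_pos (scale_pos i) (profW_pos (scale_mul_nonneg ht i))

theorem entB_le {t : ℝ} (ht : 0 ≤ t) (i : Ix) : entB t i ≤ 1 * scale i := by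
  rw [mul_comm 1]
  exact mul_le_mul_of_nonneg_left ((profB_le (scale_mul_nonneg ht i)).trans (by norm_num))
    (scale_pos i).le

theorem entW_le {t : ℝ} (ht : 0 ≤ t) (i : Ix) : entW t i ≤ 2 * scale i := by
  rw [mul_comm 2]
  exact mul_le_mul_of_nonneg_left (profW_le (scale_mul_nonneg ht i)) (scale_pos i).le

theorem abs_entB_le {t : ℝ} (ht : 0 ≤ t) (i : Ix) : |entB t i| ≤ 1 * scale i := by
  rw [abs_of_pos (entB_pos ht i)]
  exact entB_le ht i

theorem abs_entW_le {t : ℝ} (ht : 0 ≤ t) (i : Ix) : |entW t i| ≤ 2 * scale i := by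
  rw [abs_of_pos (entW_pos ht i)]
  exact entW_le ht i

theorem entB_flip (t : ℝ) (i : Ix) : entB t (flip i) = entB t i := rfl

theorem entW_flip (t : ℝ) (i : Ix) : entW t (flip i) = entW t i := rfl

theorem entB_lipschitz {u t : ℝ} (hu : 0 ≤ u) (ht : 0 ≤ t) (i : Ix) :
    |entB u i - entB t i| ≤ |u - t| * (4 * scale i) := by
  have hs := scale_pos i
  have h := profB_lipschitz (scale_mul_nonneg hu i) (scale_mul_nonneg ht i)
  rw [← mul_sub, abs_mul, abs_of_pos hs] at h
  rw [entB, entB, ← mul_sub, abs_mul, abs_of_pos hs]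
  nlinarith [mul_le_mul_of_nonneg_left h hs.le, scale_le_one i,
    mul_nonneg (mul_nonneg hs.le (abs_nonneg (u - t))) (sub_nonneg.2 (scale_le_one i))]

/-- Rescaling produces the factor `scale i ^ 3`. Two powers are dropped, as `scale i ≤ 1`; the
remaining one suffices for square-summability. -/
theorem abs_scale_taylor_le {f : ℝ → ℝ} {d L u t : ℝ} (i : Ix) (hL : 0 ≤ L)
    (h : |f (scale i * u) - f (scale i * t) - (scale i * u - scale i * t) * d|
      ≤ L * (scale i * u - scale i * t) ^ 2) :
    |scale i * f (scale i * u) - scale i * f (scale i * t) - (u - t) * (scale i ^ 2 * d)|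
      ≤ (u - t) ^ 2 * (L * scale i) := by
  have hs := scale_pos i
  have e : scale i * f (scale i * u) - scale i * f (scale i * t) - (u - t) * (scale i ^ 2 * d)
      = scale i * (f (scale i * u) - f (scale i * t) - (scale i * u - scale i * t) * d) := by
    ring
  rw [e, abs_mul, abs_of_pos hs]
  calc scale i * |f (scale i * u) - f (scale i * t) - (scale i * u - scale i * t) * d|
      ≤ scale i * (L * (scale i * u - scale i * t) ^ 2) := mul_le_mul_of_nonneg_left h hs.le
    _ = (u - t) ^ 2 * (L * scale i) * scale i ^ 2 := by ring
    _ ≤ (u - t) ^ 2 * (L * scale i) :=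
        mul_le_of_le_one_right (by positivity) (pow_le_one₀ hs.le (scale_le_one i))

theorem entB_taylor {u t : ℝ} (hu : 0 ≤ u) (ht : 0 ≤ t) (i : Ix) :
    |entB u i - entB t i - (u - t) * (-4 * (entW t i * entB t i))|
      ≤ (u - t) ^ 2 * (64 * scale i) := by
  have h := abs_scale_taylor_le i (by norm_num)
    (profB_taylor (scale_mul_nonneg hu i) (scale_mul_nonneg ht i))
  have e : -4 * (entW t i * entB t i)
      = scale i ^ 2 * (-4 * (profW (scale i * t) * profB (scale i * t))) := by
    unfold entB entW
    ring
  rw [e]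
  exact h

theorem entW_taylor {u t : ℝ} (hu : 0 ≤ u) (ht : 0 ≤ t) (i : Ix) :
    |entW u i - entW t i - (u - t) * (-16 * entB t i ^ 2)| ≤ (u - t) ^ 2 * (64 * scale i) := by
  have h := abs_scale_taylor_le i (by norm_num)
    (profW_taylor (scale_mul_nonneg hu i) (scale_mul_nonneg ht i))
  have e : -16 * entB t i ^ 2 = scale i ^ 2 * (-16 * profB (scale i * t) ^ 2) := by
    unfold entB
    ring
  rw [e]
  exact h

theorem four_mul_entB_sq_lt {t : ℝ} (ht : 0 ≤ t) (i : Ix) : 4 * entB t i ^ 2 < entW t i ^ 2 := by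
  have h := profW_sq (scale_mul_nonneg ht i)
  have hs := pow_pos (scale_pos i) 2
  rw [entB, entW, mul_pow, mul_pow, h]
  linarith

end

/-! ### The explicit flow and its decay -/

section

theorem IsWeighted.condA1 {ι : Type} {f : ι → ℝ} {W : Hil ι →L[ℂ] Hil ι}
    (hW : IsWeighted f (Equiv.refl ι) W) (hf : ∀ i, 0 ≤ f i) : CondA1 (toP W) := by
  refine ⟨?_, fun x => hW.inner_re_nonneg hf x⟩
  rw [LinearPMap.isSelfAdjoint_def, toP_adjoint,
    hW.adjoint_eq (fun _ => rfl) fun _ => rfl]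

/-- The diagonal and off-diagonal entries of the example define a flow. -/
theorem exists_isFlow_of_entries {W₀ B₀ : Hil Ix →L[ℂ] Hil Ix}
    (hW₀ : IsWeighted (entW 0) (Equiv.refl Ix) W₀) (hB₀ : IsWeighted (entB 0) flip B₀) :
    ∃ (Ω : ℝ → (Hil Ix →ₗ.[ℂ] Hil Ix)) (B : ℝ → (Hil Ix →L[ℂ] Hil Ix)),
      IsFlow (toP W₀) B₀ Ω B ∧ ∀ t, 0 ≤ t → IsWeighted (entB t) flip (B t) := by
  -- The bounds on the profiles hold for `t ≥ 0`; negative times get the irrelevant value `0`.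
  have hB : ∀ t, ∃ X : Hil Ix →L[ℂ] Hil Ix, 0 ≤ t → IsWeighted (entB t) flip X := fun t => by
    by_cases ht : 0 ≤ t
    · obtain ⟨X, hX⟩ := exists_isWeighted_of_le_scale flip (abs_entB_le ht)
      exact ⟨X, fun _ => hX⟩
    · exact ⟨0, fun h => absurd h ht⟩
  have hW : ∀ t, ∃ X : Hil Ix →L[ℂ] Hil Ix, 0 ≤ t → IsWeighted (entW t) (Equiv.refl Ix) X :=
    fun t => by
      by_cases ht : 0 ≤ t
      · obtain ⟨X, hX⟩ := exists_isWeighted_of_le_scale (Equiv.refl Ix) (abs_entW_le ht)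
        exact ⟨X, fun _ => hX⟩
      · exact ⟨0, fun h => absurd h ht⟩
  choose B hB using hB
  choose W hW using hW
  have hΔ : ∀ t, 0 ≤ t → IsWeighted (fun i => entW t i - entW 0 i) (Equiv.refl Ix) (W t - W₀) :=
    fun t ht => (hW t ht).sub hW₀
  have hBsum : ∀ t, 0 ≤ t → Summable fun i => entB t i ^ 2 := fun t ht =>
    summable_sq_of_le_scale (abs_entB_le ht)
  refine ⟨fun t => toP (W t), B, ⟨?_, ?_, ?_, ?_, ?_, ?_, ?_⟩, hB⟩
  · exact congrArg toP ((hW 0 le_rfl).ext hW₀)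
  · exact (hB 0 le_rfl).ext hB₀
  · exact fun t ht => (hW t ht).condA1 fun i => (entW_pos ht i).le
  · exact fun t ht => (hB t ht).isHS (hBsum t ht)
  · exact fun t ht => hsTendsto_of_isWeighted hB (hB t ht) (summable_const_mul_scale_sq 4)
      fun u hu i => entB_lipschitz hu ht i
  · refine ⟨fun t => W t - W₀, fun t ht => ⟨(hΔ t ht).isHS ?_, ?_, ?_⟩⟩
    · refine summable_sq_of_le_scale (M := 2 + 2) fun i => ?_
      rw [add_mul]
      exact (abs_sub _ _).trans (add_le_add (abs_entW_le ht i) (abs_entW_le le_rfl i))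
    · rw [vadd_toP, sub_add_cancel]
    · have hD : IsWeighted (fun i => -16 * entB t i ^ 2) (Equiv.refl Ix)
          (-(16 : ℂ) • (B t).comp (conjOp (B t))) := by
        rw [(hB t ht).conjOp_eq]
        have h := ((hB t ht).comp (hB t ht)).smul (-16)
        push_cast at h
        refine h.congr (fun i => ?_) flip_flip
        rw [entB_flip, ← sq]
      refine hasHSDeriv_of_isWeighted ht hΔ hD ?_ (summable_const_mul_scale_sq 64)
        fun u hu i => ?_
      · refine summable_sq_of_le_scale (M := 16) fun i => ?_
        have h1 := entB_pos ht i
        have h2 := entB_le ht i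
        have h3 := scale_le_one i
        rw [abs_mul, abs_of_nonneg (sq_nonneg (entB t i)), abs_neg, abs_of_pos (by norm_num)]
        nlinarith
      · rw [sub_sub_sub_cancel_right]
        exact entW_taylor hu ht i
  · intro t ht
    have hWt := hW t ht.le
    have hBt := hB t ht.le
    -- The diagonal weights are invariant under `flip`, so `W t` and `B t` commute and the two
    -- products add up to the factor `-4`.
    have hD : IsWeighted (fun i => -4 * (entW t i * entB t i)) flip
        (-(2 : ℂ) • ((W t).comp (B t) + (B t).comp (W t))) := by
      have h2 : IsWeighted (fun i => entB t i * entW t (flip i)) flip ((B t).comp (W t)) :=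
        hBt.comp hWt
      have h1 : IsWeighted (fun i => entW t i * entB t i) flip ((W t).comp (B t)) :=
        hWt.comp hBt
      have h := (h1.add h2).smul (-2)
      push_cast at h
      refine h.congr (fun i => ?_) fun _ => rfl
      rw [entW_flip]
      ring
    refine ⟨_, hasHSDeriv_of_isWeighted ht.le hB hD ?_ (summable_const_mul_scale_sq 64)
      fun u hu i => entB_taylor hu ht.le i, fun x => ?_⟩
    · refine summable_sq_of_le_scale (M := 8) fun i => ?_
      have h1 := entB_pos ht.le i
      have h2 := entB_le ht.le i
      have h3 := scale_le_one i
      have h4 := entW_pos ht.le i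
      have h5 := entW_le ht.le i
      rw [abs_mul, abs_of_pos (mul_pos h4 h1), abs_neg, abs_of_pos (by norm_num)]
      nlinarith [mul_le_mul h5 h2 h1.le (by linarith)]
    · refine ⟨trivial, ?_⟩
      obtain ⟨x, hx⟩ := x
      have e : transPMap (toP (W t)) = toP (W t) := by
        rw [transPMap_toP, hWt.transOp_eq (fun _ => rfl) fun _ => rfl]
      have ex : transPMap (toP (W t)) ⟨x, hx⟩ = W t x := by
        obtain ⟨_, hv⟩ := LinearPMap.ext_iff.1 e
        exact @hv x hx trivial
      rw [ex]
      rfl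

/-- A single entry suffices. For `2ⁿ ≤ t < 2ⁿ⁺¹` the scale `2⁻ⁿ` is at least `1/t`, while the
rescaled time `2⁻ⁿ t` is at most `2`, where the decreasing profile is still at least `profB 2`. -/
theorem div_le_hsNorm_of_entries {t : ℝ} (ht : 1 ≤ t) {X : Hil Ix →L[ℂ] Hil Ix}
    (hX : IsWeighted (entB t) flip X) : profB 2 / t ≤ hsNorm X := by
  have ht0 : 0 < t := by linarith
  obtain ⟨n, hn, hn'⟩ := exists_nat_pow_near ht one_lt_two
  have h := hX.abs_le_hsNorm (summable_sq_of_le_scale (abs_entB_le ht0.le)) (n, true)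
  refine le_trans ?_ ((le_abs_self _).trans h)
  have hs : scale (n, true) = (2 ^ n)⁻¹ := by simp [scale]
  have h2n : (0 : ℝ) < 2 ^ n := by positivity
  have h1 : t⁻¹ ≤ scale (n, true) := by
    rw [hs]
    exact inv_anti₀ h2n hn
  have h2 : scale (n, true) * t ≤ 2 := by
    rw [hs, inv_mul_le_iff₀ h2n]
    rw [pow_succ] at hn'
    exact hn'.le
  rw [entB, div_eq_inv_mul]
  exact mul_le_mul h1 (profB_anti (scale_mul_nonneg ht0.le _) h2) (profB_pos (by norm_num)).le
    (scale_pos _).le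

theorem not_integrableOn_of_div_le {f : ℝ → ℝ} {c : ℝ} (hc : 0 < c)
    (h : ∀ᶠ t : ℝ in atTop, c / t ≤ f t) :
    ¬ MeasureTheory.IntegrableOn f (Set.Ici 0) MeasureTheory.volume := by
  intro hf
  obtain ⟨T, hT⟩ := eventually_atTop.1 h
  have hT0 : 0 < max T 1 := lt_max_of_lt_right one_pos
  refine not_integrableOn_Ioi_inv (a := max T 1) ?_
  have hf' := (hf.mono_set (s := Set.Ioi (max T 1))
    fun t ht => (hT0.trans ht).le).const_mul c⁻¹
  refine MeasureTheory.Integrable.mono' hf' (by fun_prop) ?_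
  filter_upwards [MeasureTheory.ae_restrict_mem measurableSet_Ioi] with t ht
  have ht0 : 0 < t := hT0.trans ht
  rw [Real.norm_eq_abs, abs_of_pos (inv_pos.2 ht0), ← div_eq_inv_mul, le_div_iff₀ hc,
    ← div_eq_inv_mul]
  exact hT t ((le_max_left _ _).trans (le_of_lt ht))

/-! ### The conditions on the initial data of the example -/

/-- The numbers `ω_k` of the example. -/
def exOmega (k : ℤ) : ℝ := (1 / 2) ^ k.natAbs * profW 0

/-- The numbers `b_k` of the example. -/
def exB (k : ℕ) : ℝ := (1 / 2) ^ k * profB 0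

theorem exOmega_pos (k : ℤ) : 0 < exOmega k :=
  mul_pos (by positivity) (profW_pos le_rfl)

theorem exOmega_mode (i : Ix) : exOmega (mode i) = entW 0 i := by
  obtain ⟨k, _ | _⟩ := i <;> simp [exOmega, mode, entW, scale]

theorem entB_zero (i : Ix) : entB 0 i = exB i.1 := by
  simp [exB, entB, scale]

theorem exB_lt (k : ℕ) :
    4 * exB k ^ 2 < exOmega k ^ 2 ∧ 4 * exB k ^ 2 < exOmega (-(k : ℤ)) ^ 2 := by
  have h1 := four_mul_entB_sq_lt le_rfl (k, true)
  have h2 := four_mul_entB_sq_lt le_rfl (k, false)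
  rw [entB_zero, ← exOmega_mode] at h1 h2
  exact ⟨h1, h2⟩

theorem isBlockB_iff {b : ℕ → ℝ} {B : Hil Ix →L[ℂ] Hil Ix} :
    IsBlockB b B ↔ IsWeighted (fun i => b i.1) flip B :=
  ⟨fun h x i => h x i.1 i.2, fun h x k s => h x (k, s)⟩

theorem blockOmega_exOmega {W : Hil Ix →L[ℂ] Hil Ix}
    (hW : IsWeighted (entW 0) (Equiv.refl Ix) W) : blockOmega exOmega = toP W := by
  refine diagOp_eq_toP (hW.congr (fun i => (exOmega_mode i).symm) fun _ => rfl)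

/-- The weights of the product are a constant times the powers of `(1/2)^ε`, and this ratio is less
than `1` because `ε > 0`. -/
theorem mulIsHS_blockPow {B : Hil Ix →L[ℂ] Hil Ix} (hB : IsWeighted (entB 0) flip B) {ε : ℝ}
    (hε : 0 < ε) : MulIsHS (blockPow exOmega (-1 + ε)) B := by
  set K : ℝ := profW 0 ^ (-1 + ε) * profB 0
  set c : Ix → ℝ := fun i => exOmega (mode i) ^ (-1 + ε) * entB 0 i with hc
  have hcK : ∀ i, c i = K * ((1 / 2 : ℝ) ^ ε) ^ i.1 := fun i => by
    have hs := scale_pos i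
    have h1 : scale i ^ (-1 + ε) * scale i = scale i ^ ε := by
      rw [← Real.rpow_add_one hs.ne']
      congr 1
      ring
    have h2 : scale i ^ ε = ((1 / 2 : ℝ) ^ ε) ^ i.1 := by
      rw [scale, ← Real.rpow_natCast, ← Real.rpow_natCast, ← Real.rpow_mul (by norm_num),
        ← Real.rpow_mul (by norm_num), mul_comm]
    simp only [hc]
    rw [← h2, ← h1, exOmega_mode, entW, entB, mul_zero,
      Real.mul_rpow hs.le (profW_pos le_rfl).le]
    ring
  have hsum : Summable fun i => c i ^ 2 := by
    simp only [hcK, mul_pow K]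
    exact (summable_geometric_Ix (by positivity)
      (Real.rpow_lt_one (by norm_num) (by norm_num) hε)).mul_left _
  obtain ⟨C, hC⟩ := exists_isWeighted c flip (tsum_nonneg fun _ => sq_nonneg _)
    fun i => hsum.le_tsum i fun _ _ => sq_nonneg _
  have e : ∀ x, (fun i => ((exOmega (mode i) ^ (-1 + ε) : ℝ) : ℂ) * B x i) = C x := fun x =>
    funext fun i => by
      rw [hC, hB, ← mul_assoc, ← Complex.ofReal_mul]
  refine ⟨C, hC.isHS hsum, fun x => ⟨?_, lp.ext (e x)⟩⟩
  change Memℓp (fun i => ((exOmega (mode i) ^ (-1 + ε) : ℝ) : ℂ) * B x i) 2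
  rw [e]
  exact lp.memℓp (C x)

/-- The number `b_k / ω_k` of the example. -/
def exQuot : ℝ := profB 0 / profW 0

theorem entB_zero_eq (i : Ix) : entB 0 i = entW 0 i * exQuot := by
  have h := (profW_pos le_rfl).ne'
  rw [entB, entW, exQuot, mul_zero]
  field_simp

theorem four_mul_exQuot_sq_lt : 4 * exQuot ^ 2 < 1 := by
  have h := profW_pos le_rfl
  rw [exQuot, div_pow, ← mul_div_assoc, div_lt_one (by positivity), profW_sq le_rfl]
  linarith

/-- This is the bounded operator `Ω₀⁻¹B₀`; it supplies the preimages under `Ω₀` and `Ω₀ᵗ` required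
in `CondA3` and `StrictIneq`. -/
theorem exists_quot : ∃ Y : Hil Ix →L[ℂ] Hil Ix, IsWeighted (fun _ => exQuot) flip Y :=
  exists_isWeighted _ _ (sq_nonneg exQuot) fun _ => le_rfl

section InitialConditions

variable {W B Y : Hil Ix →L[ℂ] Hil Ix}

theorem omega_quot (hW : IsWeighted (entW 0) (Equiv.refl Ix) W)
    (hB : IsWeighted (entB 0) flip B) (hY : IsWeighted (fun _ => exQuot) flip Y) :
    W.comp Y = B :=
  ((hW.comp hY).congr (fun i => (entB_zero_eq i).symm) fun _ => rfl).ext hB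

theorem exists_transPMap_eq (hW : IsWeighted (entW 0) (Equiv.refl Ix) W)
    (hB : IsWeighted (entB 0) flip B) (hY : IsWeighted (fun _ => exQuot) flip Y) (x : Hil Ix) :
    ∃ y : (transPMap (toP W)).domain, transPMap (toP W) y = conjOp B x ∧ (y : Hil Ix) = Y x := by
  rw [transPMap_toP, hW.transOp_eq (fun _ => rfl) fun _ => rfl, hB.conjOp_eq,
    ← omega_quot hW hB hY]
  exact ⟨⟨Y x, trivial⟩, rfl, rfl⟩

theorem condA2_example (hB : IsWeighted (entB 0) flip B) : CondA2 B := by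
  refine ⟨hB.transOp_eq flip_flip (entB_flip 0),
    hB.isHS (summable_sq_of_le_scale (abs_entB_le le_rfl)), ?_⟩
  rintro rfl
  have h := hB (lp.single 2 (0, true) 1) (0, false)
  have e : flip (0, false) = (0, true) := rfl
  rw [e, lp.single_apply_self, mul_one] at h
  exact (entB_pos le_rfl (0, false)).ne (Complex.ofReal_injective h)

theorem condA3_example (hW : IsWeighted (entW 0) (Equiv.refl Ix) W)
    (hB : IsWeighted (entB 0) flip B) (hY : IsWeighted (fun _ => exQuot) flip Y) :
    CondA3 (toP W) B := by
  refine ⟨fun z => ⟨⟨Y z, trivial⟩, DFunLike.congr_fun (omega_quot hW hB hY) z, ?_⟩, fun x => ?_⟩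
  · rintro ⟨y, hy⟩ hyz
    have h : W y = W (Y z) :=
      Eq.trans hyz (DFunLike.congr_fun (omega_quot hW hB hY) z).symm
    refine Subtype.ext (lp.ext (funext fun i => ?_))
    have hi : W y i = W (Y z) i := by rw [h]
    rw [hW, hW] at hi
    exact mul_left_cancel₀ (Complex.ofReal_ne_zero.2 (entW_pos le_rfl i).ne') hi
  · obtain ⟨x, hx⟩ := x
    obtain ⟨y, hy, hyx⟩ := exists_transPMap_eq hW hB hY x
    refine ⟨y, hy, ?_⟩
    have hBY : IsWeighted (fun i => entB 0 i * exQuot) (Equiv.refl Ix) (B.comp Y) :=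
      (hB.comp hY).congr (fun _ => rfl) flip_flip
    -- `W - 4 B Y` is diagonal with entries `entW 0 i * (1 - 4 * exQuot ^ 2)`, which are positive.
    have h := (hW.sub (hBY.smul 4)).inner_re_nonneg (fun i => ?_) x
    · have e : (W - ((4 : ℝ) : ℂ) • B.comp Y) x = W x - ((4 : ℝ) : ℂ) • B (Y x) := rfl
      rw [e, inner_sub_right, inner_smul_right, Complex.sub_re, Complex.re_ofReal_mul] at h
      rw [hyx]
      exact sub_nonneg.1 h
    · rw [entB_zero_eq]
      nlinarith [entW_pos le_rfl i, four_mul_exQuot_sq_lt]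

theorem strictIneq_example (hW : IsWeighted (entW 0) (Equiv.refl Ix) W)
    (hB : IsWeighted (entB 0) flip B) (hY : IsWeighted (fun _ => exQuot) flip Y) :
    StrictIneq (toP W) B := by
  intro x hx
  obtain ⟨y, hy, hyx⟩ := exists_transPMap_eq hW hB hY x
  refine ⟨y, hy, ?_⟩
  -- `Y` is `exQuot` times a permutation of coordinates, hence a multiple of an isometry.
  have e : ‖Y x‖ ^ 2 = exQuot ^ 2 * ‖x‖ ^ 2 := by
    rw [hil_norm_sq, hil_norm_sq, ← tsum_mul_left, ← flip.tsum_eq fun i => exQuot ^ 2 * ‖x i‖ ^ 2]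
    refine tsum_congr fun i => ?_
    rw [hY, norm_mul, mul_pow, Complex.norm_real, Real.norm_eq_abs, sq_abs]
  rw [hyx, e]
  nlinarith [four_mul_exQuot_sq_lt, pow_pos (norm_pos_iff.2 hx) 2]

end InitialConditions

end

end

end QuadFlow

theorem mainTheorem10 :
    ∃ (ω : ℤ → ℝ) (b : ℕ → ℝ) (B₀ : QuadFlow.Hil QuadFlow.Ix →L[ℂ] QuadFlow.Hil QuadFlow.Ix),
      (∀ k, 0 < ω k) ∧
      QuadFlow.IsBlockB b B₀ ∧
      QuadFlow.CondA1 (QuadFlow.blockOmega ω) ∧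
      QuadFlow.CondA2 B₀ ∧
      QuadFlow.CondA3 (QuadFlow.blockOmega ω) B₀ ∧
      QuadFlow.MulIsHS (QuadFlow.blockPow ω (-1 / 2)) B₀ ∧
      (∀ k : ℕ, 4 * b k ^ 2 < ω k ^ 2 ∧ 4 * b k ^ 2 < ω (-(k : ℤ)) ^ 2) ∧
      QuadFlow.StrictIneq (QuadFlow.blockOmega ω) B₀ ∧
      (∀ ε : ℝ, 0 < ε → QuadFlow.MulIsHS (QuadFlow.blockPow ω (-1 + ε)) B₀) ∧
      ∃ (Ω : ℝ → (QuadFlow.Hil QuadFlow.Ix →ₗ.[ℂ] QuadFlow.Hil QuadFlow.Ix))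
        (B : ℝ → (QuadFlow.Hil QuadFlow.Ix →L[ℂ] QuadFlow.Hil QuadFlow.Ix)),
        QuadFlow.IsFlow (QuadFlow.blockOmega ω) B₀ Ω B ∧
        (∀ Ω' B', QuadFlow.IsFlow (QuadFlow.blockOmega ω) B₀ Ω' B' →
          ∀ t, 0 ≤ t → Ω' t = Ω t ∧ B' t = B t) ∧
        (∃ c : ℝ, 0 < c ∧ ∀ᶠ t : ℝ in Filter.atTop, c / t ≤ QuadFlow.hsNorm (B t)) ∧
        ¬ MeasureTheory.IntegrableOn (fun t : ℝ => QuadFlow.hsNorm (B t)) (Set.Ici 0)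
          MeasureTheory.volume := by
  open QuadFlow in
  obtain ⟨W, hW⟩ := exists_isWeighted_of_le_scale (Equiv.refl Ix) (abs_entW_le le_rfl)
  obtain ⟨B₀, hB₀⟩ := exists_isWeighted_of_le_scale flip (abs_entB_le le_rfl)
  obtain ⟨Y, hY⟩ := exists_quot
  obtain ⟨Ω, B, hflow, hB⟩ := exists_isFlow_of_entries hW hB₀
  have hc : 0 < profB 2 := profB_pos (by norm_num)
  have hlow : ∀ᶠ t : ℝ in Filter.atTop, profB 2 / t ≤ hsNorm (B t) :=
    (Filter.eventually_ge_atTop 1).mono fun t ht =>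
      div_le_hsNorm_of_entries ht (hB t (zero_le_one.trans ht))
  refine ⟨exOmega, exB, B₀, exOmega_pos,
    isBlockB_iff.2 (hB₀.congr entB_zero fun _ => rfl), ?_⟩
  rw [blockOmega_exOmega hW]
  refine ⟨hW.condA1 fun i => (entW_pos le_rfl i).le, condA2_example hB₀,
    condA3_example hW hB₀ hY, ?_, exB_lt, strictIneq_example hW hB₀ hY,
    fun ε hε => mulIsHS_blockPow hB₀ hε, Ω, B, hflow,
    fun Ω' B' h' t ht => hflow.unique h' ht, ⟨_, hc, hlow⟩, not_integrableOn_of_div_le hc hlow⟩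
  -- Condition (A4) is the case `ε = 1/2` of the third property.
  have e : (-1 / 2 : ℝ) = -1 + 1 / 2 := by norm_num
  rw [e]
  exact mulIsHS_blockPow hB₀ (by norm_num)
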